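/- For a Tychonoff space $X$, let $C_p(X)$ be the space of all continuous real-valued functions on $X$ with the topology of pointwise convergence. A Tychonoff space is called a $\kappa$-space if it is homeomorphic to a closed subspace of $C_p(Y)$ for some locally compact (Hausdorff) space $Y$; it is realcompact if it is homeomorphic to a closed subspace of a power $\mathbb{R}^{I}$ of the real line; and it is Dieudonné complete if its topology is induced by some complete uniformity. Let the ordinal $\omega_1+1$ carry its order topology. Then $C_p(\omega_1+1)$ is a Fréchet–Urysohn $\kappa$-space which is neither realcompact nor Dieudonné complete. In particular, there are Fréchet–Urysohn $\kappa$-spaces which are not Dieudonné complete. -/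

import Mathlib

open scoped Ordinal

universe u

/-- The ordinal `ω₁ + 1` as a linearly ordered set, whose elements are (in order) the
ordinals `≤ ω₁`. -/
abbrev OmegaOneAddOne : Type u := (ω₁ + 1 : Ordinal.{u}).ToType

/-- `ω₁ + 1` carries its order topology. -/
noncomputable instance OmegaOneAddOne.instTopologicalSpace : TopologicalSpace OmegaOneAddOne.{u} :=
  Preorder.topology OmegaOneAddOne.{u}

instance OmegaOneAddOne.instOrderTopology : OrderTopology OmegaOneAddOne.{u} := ⟨rfl⟩

/-- `C_p(X)`: the continuous real-valued functions on `X` with the topology of pointwise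
convergence, that is, with the subspace topology inherited from the product `X → ℝ`. -/
abbrev Cp (X : Type u) [TopologicalSpace X] : Type u := {f : X → ℝ // Continuous f}

/-- A `κ`-space: a Tychonoff space homeomorphic to a closed subspace of `C_p(Y)` for some
(Hausdorff) locally compact space `Y`. -/
def IsKappaSpace (X : Type u) [TopologicalSpace X] : Prop :=
  T35Space X ∧
    ∃ (Y : Type u) (_ : TopologicalSpace Y) (_ : T2Space Y) (_ : LocallyCompactSpace Y)
      (e : X → Cp Y), Topology.IsClosedEmbedding e

/-- A realcompact space: a Tychonoff space homeomorphic to a closed subspace of a power of `ℝ`.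
(An index set `ι` in the universe of `X` is no restriction: the family of all
continuous `f : X → ℝ` can serve as index set whenever some index set does.) -/
def IsRealcompactSpace (X : Type u) [TopologicalSpace X] : Prop :=
  T35Space X ∧ ∃ (ι : Type u) (e : X → (ι → ℝ)), Topology.IsClosedEmbedding e

/-- A Dieudonné complete space: a Tychonoff space whose topology is induced by some complete
uniformity. -/
def IsDieudonneComplete (X : Type u) [t : TopologicalSpace X] : Prop :=
  T35Space X ∧ ∃ U : UniformSpace X, U.toTopologicalSpace = t ∧ @CompleteSpace X U

open Set Filter Topology Uniformity

/-! ### Spaces of the form `C_p(X)` -/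

section Cp

variable {X : Type u} [TopologicalSpace X]

/-! A continuous function on `ω₁ + 1` is constant on some `[a, ω₁]` with `a < ω₁`
(`exists_lt_top_forall_eq`), so countably many of them only see a countable set of points.
Compactness of `ω₁ + 1` gives countable tightness of `C_p`, and closures of countable sets can then
be tested in a metrizable countable power of `ℝ`: this is Fréchet–Urysohn. Compactness also makes
`C_p(ω₁ + 1)` trivially a `κ`-space. For incompleteness, the indicators of `(a, ω₁]` converge
pointwise to the discontinuous indicator of `{ω₁}`, yet on any countable set they are eventually
constant in `a`. Entourages of a compatible uniformity depend on countably many coordinates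
(`Cp.exists_countable_eqOn_mem_uniformity`), so this net is Cauchy for each such uniformity. -/

theorem Cp.tendsto_iff {ι : Type*} {l : Filter ι} {F : ι → Cp X} {f : Cp X} :
    Tendsto F l (𝓝 f) ↔ ∀ x, Tendsto (fun i => (F i).1 x) l (𝓝 (f.1 x)) := by
  rw [tendsto_subtype_rng, tendsto_pi_nhds]

/-- The basic open subset of `C_p(X)` cut out by finitely many constraints `q < f x < r`, where
`q` and `r` are rational. -/
def Cp.box (L : Finset (X × ℚ × ℚ)) : Set (Cp X) :=
  {f | ∀ p ∈ L, (p.2.1 : ℝ) < f.1 p.1 ∧ f.1 p.1 < p.2.2}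

theorem Cp.exists_box_subset {f : Cp X} {O : Set (Cp X)} (hO : O ∈ 𝓝 f) :
    ∃ L, f ∈ Cp.box L ∧ Cp.box L ⊆ O := by
  classical
  rw [nhds_subtype_eq_comap, mem_comap] at hO
  obtain ⟨t, ht, htO⟩ := hO
  rw [nhds_pi, Filter.mem_pi] at ht
  obtain ⟨I, hI, s, hs, hst⟩ := ht
  have h : ∀ x, ∃ p : ℚ × ℚ, ((p.1 : ℝ) < f.1 x ∧ f.1 x < p.2) ∧
      ∀ y : ℝ, (p.1 : ℝ) < y ∧ y < p.2 → y ∈ s x := by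
    intro x
    obtain ⟨a, b, hab, habs⟩ := mem_nhds_iff_exists_Ioo_subset.1 (hs x)
    obtain ⟨q, hq, hq'⟩ := exists_rat_btwn hab.1
    obtain ⟨r, hr, hr'⟩ := exists_rat_btwn hab.2
    exact ⟨(q, r), ⟨hq', hr⟩, fun y hy => habs ⟨hq.trans hy.1, hy.2.trans hr'⟩⟩
  choose p hp hps using h
  refine ⟨hI.toFinset.image fun x => (x, p x), ?_, ?_⟩
  · intro z hz
    obtain ⟨x, -, rfl⟩ := Finset.mem_image.1 hz
    exact hp x
  · intro g hg
    refine htO (hst fun x hx => hps x _ ?_)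
    exact hg (x, p x) (Finset.mem_image.2 ⟨x, hI.mem_toFinset.2 hx, rfl⟩)

theorem Cp.exists_eq_on_finite [T1Space X] [NormalSpace X] {s : Set X} (hs : s.Finite)
    (v : X → ℝ) : ∃ f : Cp X, ∀ x ∈ s, f.1 x = v x := by
  have : Finite s := hs
  obtain ⟨g, hg⟩ := ContinuousMap.exists_restrict_eq hs.isClosed
    (⟨fun x : s => v x, continuous_of_discreteTopology⟩ : C(s, ℝ))
  exact ⟨⟨g, g.continuous⟩, fun x hx => DFunLike.congr_fun hg ⟨x, hx⟩⟩

/-- A countable set of points which supports, with every finite set of rational constraints that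
it supports, also the image of that set under a given operation. -/
theorem exists_countable_support_closed {X B : Type*} [Countable B]
    (φ : Finset (X × B) → Finset (X × B)) :
    ∃ A : Set X, A.Countable ∧
      ∀ R : Finset (X × B), (∀ p ∈ R, p.1 ∈ A) → ∀ p ∈ φ R, p.1 ∈ A := by
  let step : Set X → Set X := fun A =>
    A ∪ ⋃ R ∈ {R : Finset (X × B) | (R : Set (X × B)) ⊆ A ×ˢ univ}, Prod.fst '' (φ R : Set (X × B))
  let S : ℕ → Set X := fun n => step^[n] ∅
  have hS : ∀ n, S (n + 1) = step (S n) := fun n => Function.iterate_succ_apply' step n ∅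
  have hmono : Monotone S := monotone_nat_of_le_succ fun n => by
    rw [hS]; exact subset_union_left
  have hcount : ∀ n, (S n).Countable := by
    intro n
    induction n with
    | zero => exact countable_empty
    | succ n ih =>
      rw [hS]
      refine ih.union (Countable.biUnion ?_ fun R _ => (φ R).countable_toSet.image _)
      refine ((countable_ofPred_finite_subset (ih.prod (countable_univ (α := B)))).preimage
        Finset.coe_injective).mono ?_
      exact fun R hR => ⟨R.finite_toSet, hR⟩
  refine ⟨⋃ n, S n, countable_iUnion hcount, fun R hR p hp => ?_⟩
  obtain ⟨n, hn⟩ : ∃ n, ∀ p ∈ R, p.1 ∈ S n := by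
    choose! k hk using fun p hp => mem_iUnion.1 (hR p hp)
    exact ⟨R.sup k, fun p hp => hmono (Finset.le_sup hp) (hk p hp)⟩
  refine mem_iUnion.2 ⟨n + 1, ?_⟩
  rw [hS]
  refine Or.inr (mem_biUnion (x := R) (fun q hq => ⟨hn q hq, mem_univ _⟩) ?_)
  exact mem_image_of_mem _ hp

/-- Every entourage of a uniformity inducing the topology of `C_p(X)` depends on countably many
coordinates. -/
theorem Cp.exists_countable_eqOn_mem_uniformity [T1Space X] [NormalSpace X]
    (U : UniformSpace (Cp X)) (hU : U.toTopologicalSpace = instTopologicalSpaceSubtype)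
    {V : Set (Cp X × Cp X)} (hV : V ∈ 𝓤[U]) :
    ∃ A : Set X, A.Countable ∧ ∀ f g : Cp X, EqOn f.1 g.1 A → (f, g) ∈ V := by
  classical
  obtain ⟨W₀, hW₀, hWV⟩ : ∃ W ∈ 𝓤[U], ∀ a b c d : Cp X,
      (a, b) ∈ W → (b, c) ∈ W → (c, d) ∈ W → (a, d) ∈ V := by
    obtain ⟨t, ht, htV⟩ := @comp3_mem_uniformity _ U V hV
    exact ⟨t, ht, fun a b c d h₁ h₂ h₃ => htV ⟨b, h₁, c, h₂, h₃⟩⟩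
  obtain ⟨W, hW, hWs, hWW⟩ := @comp_symm_mem_uniformity_sets _ U W₀ hW₀
  have hsmall : ∀ f : Cp X, ∃ L, f ∈ Cp.box L ∧ ∀ a ∈ Cp.box L, ∀ b ∈ Cp.box L, (a, b) ∈ W₀ := by
    intro f
    have hf : {g | (f, g) ∈ W} ∈ 𝓝 f := by
      rw [← hU]; exact @mem_nhds_left _ U f W hW
    obtain ⟨L, hfL, hL⟩ := Cp.exists_box_subset hf
    exact ⟨L, hfL, fun a ha b hb => hWW ⟨f, hWs.symm _ _ (hL ha), hL hb⟩⟩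
  -- `φ R` will be a `W₀`-small nonempty box refining `R` whenever one exists; `∅` is a dummy value
  -- otherwise.
  have hext : ∀ R : Finset (X × ℚ × ℚ), ∃ L : Finset (X × ℚ × ℚ),
      (∃ M, R ⊆ M ∧ (Cp.box M).Nonempty ∧ ∀ a ∈ Cp.box M, ∀ b ∈ Cp.box M, (a, b) ∈ W₀) →
      R ⊆ L ∧ (Cp.box L).Nonempty ∧ ∀ a ∈ Cp.box L, ∀ b ∈ Cp.box L, (a, b) ∈ W₀ := by
    intro R
    by_cases h : ∃ M, R ⊆ M ∧ (Cp.box M).Nonempty ∧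
        ∀ a ∈ Cp.box M, ∀ b ∈ Cp.box M, (a, b) ∈ W₀
    · exact h.imp fun M hM _ => hM
    · exact ⟨∅, fun h' => absurd h' h⟩
  choose φ hφ using hext
  obtain ⟨A, hA, hφA⟩ := exists_countable_support_closed φ
  refine ⟨A, hA, fun f g hfg => ?_⟩
  obtain ⟨Lf, hfLf, hLf⟩ := hsmall f
  obtain ⟨Lg, hgLg, hLg⟩ := hsmall g
  set R := (Lf ∪ Lg).filter fun p => p.1 ∈ A with hR
  have hRA : ∀ p ∈ R, p.1 ∈ A := fun p hp => (Finset.mem_filter.1 hp).2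
  have hRf : f ∈ Cp.box R := by
    intro p hp
    obtain ⟨hp, hpA⟩ := Finset.mem_filter.1 hp
    rcases Finset.mem_union.1 hp with h | h
    · exact hfLf p h
    · rw [hfg hpA]; exact hgLg p h
  -- The small box `R ∪ Lf` contains `f`, so `φ R` is not the dummy value.
  obtain ⟨hRL, ⟨h, hhL⟩, hL⟩ := hφ R ⟨R ∪ Lf, Finset.subset_union_left,
    ⟨f, fun p hp => (Finset.mem_union.1 hp).elim (hRf p) (hfLf p)⟩,
    fun a ha b hb => hLf a (fun p hp => ha p (Finset.mem_union_right _ hp))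
      b (fun p hp => hb p (Finset.mem_union_right _ hp))⟩
  -- Take the values of `h` on `A` and of `k` off `A`: constraints of `M` over `A` lie in `R ⊆ φ R`,
  -- and `φ R` is supported in `A`. The box of `φ R` thus links those of `Lf` and `Lg`.
  have hmeet : ∀ (k : Cp X) (M : Finset (X × ℚ × ℚ)), k ∈ Cp.box M →
      (∀ p ∈ M, p.1 ∈ A → p ∈ R) → ∃ k' ∈ Cp.box M, k' ∈ Cp.box (φ R) := by
    intro k M hk hM
    obtain ⟨k', hk'⟩ := Cp.exists_eq_on_finite
      (s := Prod.fst '' ((M ∪ φ R : Finset (X × ℚ × ℚ)) : Set (X × ℚ × ℚ)))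
      ((Finset.finite_toSet _).image _) (fun x => if x ∈ A then h.1 x else k.1 x)
    refine ⟨k', fun p hp => ?_, fun p hp => ?_⟩
    · rw [hk' p.1 (mem_image_of_mem _ (Finset.mem_union_left _ hp))]
      split_ifs with hpA
      · exact hhL p (hRL (hM p hp hpA))
      · exact hk p hp
    · rw [hk' p.1 (mem_image_of_mem _ (Finset.mem_union_right _ hp)),
        if_pos (hφA R hRA p hp)]
      exact hhL p hp
  obtain ⟨f', hf', hf'L⟩ := hmeet f Lf hfLf fun p hp hpA =>
    Finset.mem_filter.2 ⟨Finset.mem_union_left _ hp, hpA⟩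
  obtain ⟨g', hg', hg'L⟩ := hmeet g Lg hgLg fun p hp hpA =>
    Finset.mem_filter.2 ⟨Finset.mem_union_right _ hp, hpA⟩
  exact hWV f f' g' g (hLf f hfLf f' hf') (hL f' hf'L g' hg'L) (hLg g' hg' g hgLg)

/-- Over a compact space, `C_p(X)` has countable tightness. -/
theorem Cp.exists_countable_mem_closure [CompactSpace X] {S : Set (Cp X)} {f : Cp X}
    (hf : f ∈ closure S) : ∃ T ⊆ S, T.Countable ∧ f ∈ closure T := by
  have key : ∀ n m : ℕ, ∃ T : Finset (Cp X), (T : Set (Cp X)) ⊆ S ∧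
      ∀ x : Fin n → X, ∃ h ∈ T, ∀ i, |h.1 (x i) - f.1 (x i)| < 1 / ((m : ℝ) + 1) := by
    intro n m
    have hm : (0 : ℝ) < 1 / ((m : ℝ) + 1) := by positivity
    -- These sets cover the compact power `X ^ n`; a finite subcover gives finitely many
    -- approximants for all `n`-tuples.
    let O : S → Set (Fin n → X) := fun h =>
      {x | ∀ i, |h.1.1 (x i) - f.1 (x i)| < 1 / ((m : ℝ) + 1)}
    have hO : ∀ h, IsOpen (O h) := by
      intro h
      have : O h = ⋂ i, {x | |h.1.1 (x i) - f.1 (x i)| < 1 / ((m : ℝ) + 1)} := by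
        ext x; simp [O]
      rw [this]
      refine isOpen_iInter_of_finite fun i => isOpen_lt ?_ continuous_const
      exact (((h.1.2.comp (continuous_apply i)).sub (f.2.comp (continuous_apply i)))).abs
    have hcov : (univ : Set (Fin n → X)) ⊆ ⋃ h, O h := by
      intro x _
      have hN : {h : Cp X | ∀ i, |h.1 (x i) - f.1 (x i)| < 1 / ((m : ℝ) + 1)} ∈ 𝓝 f := by
        rw [ofPred_forall, Filter.iInter_mem]
        intro i
        have hc : Continuous fun h : Cp X => |h.1 (x i) - f.1 (x i)| :=
          (((continuous_apply (x i)).comp continuous_subtype_val).sub continuous_const).abs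
        exact (isOpen_lt hc continuous_const).mem_nhds (by simpa using hm)
      obtain ⟨h, hh, hS⟩ := mem_closure_iff_nhds.1 hf _ hN
      exact mem_iUnion.2 ⟨⟨h, hS⟩, hh⟩
    obtain ⟨t, ht⟩ := isCompact_univ.elim_finite_subcover O hO hcov
    classical
    refine ⟨t.image Subtype.val, ?_, fun x => ?_⟩
    · intro h hh
      obtain ⟨k, -, rfl⟩ := Finset.mem_image.1 (Finset.mem_coe.1 hh)
      exact k.2
    · obtain ⟨k, hk, hx⟩ := mem_iUnion₂.1 (ht (mem_univ x))
      exact ⟨k, Finset.mem_image_of_mem _ hk, hx⟩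
  choose T hTS hT using key
  refine ⟨⋃ n, ⋃ m, (T n m : Set (Cp X)), iUnion_subset fun n => iUnion_subset fun m => hTS n m,
    countable_iUnion fun n => countable_iUnion fun m => (T n m).countable_toSet, ?_⟩
  rw [mem_closure_iff_nhds]
  intro N hN
  rw [nhds_subtype_eq_comap, mem_comap] at hN
  obtain ⟨t, ht, htN⟩ := hN
  rw [nhds_pi, Filter.mem_pi] at ht
  obtain ⟨I, hI, s, hs, hst⟩ := ht
  have hI' : ∃ m : ℕ, ∀ x ∈ I, Metric.ball (f.1 x) (1 / ((m : ℝ) + 1)) ⊆ s x := by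
    have : ∀ᶠ m : ℕ in atTop, ∀ x ∈ I, Metric.ball (f.1 x) (1 / ((m : ℝ) + 1)) ⊆ s x := by
      rw [hI.eventually_all]
      intro x _
      obtain ⟨ε, hε, hεs⟩ := Metric.mem_nhds_iff.1 (hs x)
      filter_upwards [tendsto_one_div_add_atTop_nhds_zero_nat.eventually_lt_const hε] with m hm
      exact (Metric.ball_subset_ball hm.le).trans hεs
    exact this.exists
  obtain ⟨m, hm⟩ := hI'
  obtain ⟨n, x, hx⟩ := hI.fin_param
  obtain ⟨h, hh, hhx⟩ := hT n m x
  refine ⟨h, htN (hst fun y hy => ?_), mem_iUnion₂.2 ⟨n, m, hh⟩⟩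
  rw [← hx.2] at hy
  obtain ⟨i, rfl⟩ := hy
  exact hm _ (hx.2 ▸ mem_range_self i) (by simpa [Real.dist_eq] using hhx i)

/-- If `X` is compact and every countable family of continuous functions on `X` is determined by
its values on a countable set that represents all points, then `C_p(X)` is Fréchet–Urysohn. -/
theorem Cp.frechetUrysohnSpace [CompactSpace X]
    (hX : ∀ T : Set (Cp X), T.Countable → ∃ D : Set X, D.Countable ∧
      ∀ x, ∃ d ∈ D, ∀ h ∈ T, h.1 x = h.1 d) : FrechetUrysohnSpace (Cp X) := by
  refine ⟨fun S f hf => ?_⟩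
  obtain ⟨T, hTS, hTc, hfT⟩ := Cp.exists_countable_mem_closure hf
  obtain ⟨D, hD, hDT⟩ := hX (insert f T) (hTc.insert f)
  have : Countable D := hD
  let r : Cp X → (D → ℝ) := fun h d => h.1 d
  have hr : Continuous r :=
    continuous_pi fun d => (continuous_apply d.1).comp continuous_subtype_val
  obtain ⟨u, hu, hlim⟩ := mem_closure_iff_seq_limit.1
    (image_closure_subset_closure_image hr (mem_image_of_mem r hfT))
  choose F hFT hFu using hu
  refine ⟨F, fun n => hTS (hFT n), Cp.tendsto_iff.2 fun x => ?_⟩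
  obtain ⟨d, hd, hdx⟩ := hDT x
  have h₁ := tendsto_pi_nhds.1 hlim ⟨d, hd⟩
  rw [hdx f (mem_insert _ _)]
  refine h₁.congr fun n => ?_
  rw [← hFu n, hdx _ (mem_insert_of_mem _ (hFT n))]

end Cp

/-- A closed subspace of a power of `ℝ` inherits a complete uniformity. -/
theorem IsRealcompactSpace.isDieudonneComplete {X : Type u} [t : TopologicalSpace X]
    (h : IsRealcompactSpace X) : IsDieudonneComplete X := by
  obtain ⟨hX, ι, e, he⟩ := h
  let U : UniformSpace X := UniformSpace.comap e inferInstance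
  refine ⟨hX, U, ?_, ?_⟩
  · exact he.toIsEmbedding.eq_induced.symm
  · exact (@IsUniformInducing.completeSpace _ _ U _ e ⟨rfl⟩) he.isClosed_range.isComplete


/-! ### The space `ω₁ + 1` -/

namespace OmegaOneAddOne
open Ordinal

/-- The largest element `ω₁` of `ω₁ + 1`. -/
noncomputable instance instOrderTop : OrderTop OmegaOneAddOne.{u} where
  top := Ordinal.ToType.mk ⟨ω₁, by simp⟩
  le_top a := by
    rw [← OrderIso.symm_apply_le, ← Subtype.coe_le_coe]
    exact Order.lt_add_one_iff.1 (Ordinal.ToType.mk.symm a).2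

theorem lt_top_iff {a : OmegaOneAddOne.{u}} : a < ⊤ ↔ (a : Ordinal) < ω₁ := by
  have h : (⊤ : OmegaOneAddOne.{u}) = Ordinal.ToType.mk ⟨ω₁, by simp⟩ := rfl
  rw [h, ← OrderIso.symm_apply_lt]
  rfl

theorem _root_.Ordinal.countable_Iic_of_lt_omega_one {o : Ordinal.{u}} (ho : o < ω₁) :
    (Iic o).Countable := by
  have h : Order.succ o < ω₁ := (Cardinal.isSuccLimit_omega 1).succ_lt ho
  rw [← Cardinal.ord_aleph, Cardinal.lt_ord, ← Cardinal.succ_aleph0, Order.lt_succ_iff] at h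
  rw [← Order.Iio_succ, ← Cardinal.le_aleph0_iff_set_countable, Cardinal.mk_Iio_ordinal]
  exact Cardinal.lift_le_aleph0.2 h

theorem countable_Iic {a : OmegaOneAddOne.{u}} (ha : a < ⊤) : (Iic a).Countable :=
  ((Ordinal.countable_Iic_of_lt_omega_one (lt_top_iff.1 ha)).preimage
    (f := fun x : OmegaOneAddOne.{u} => (x : Ordinal.{u}))
    (Subtype.val_injective.comp Ordinal.ToType.mk.symm.injective)).mono fun _ hx =>
      Ordinal.ToType.mk.symm.monotone hx

/-- Uncountable cofinality of `ω₁`; taking successors makes the bound strict. -/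
theorem exists_lt_top_of_countable {s : Set OmegaOneAddOne.{u}} (hs : s.Countable)
    (hlt : ∀ x ∈ s, x < ⊤) : ∃ b < ⊤, ∀ x ∈ s, x < b := by
  have : Countable s := hs
  have hsup : ⨆ x : s, Order.succ (x.1 : Ordinal) < ω₁ :=
    Ordinal.iSup_lt_omega_one fun x => 
      (Cardinal.isSuccLimit_omega 1).succ_lt (lt_top_iff.1 (hlt x x.2))
  refine ⟨Ordinal.ToType.mk ⟨_, hsup.trans (by simp)⟩, ?_, fun x hx => ?_⟩
  · rw [lt_top_iff]; simpa using hsup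
  · rw [← OrderIso.symm_apply_lt, ← Subtype.coe_lt_coe]
    simpa using (Order.lt_succ _).trans_le (Ordinal.le_iSup
      (fun x : s => Order.succ (x.1 : Ordinal)) ⟨x, hx⟩)

instance instCompactSpace : CompactSpace OmegaOneAddOne.{u} := by
  have : Nonempty OmegaOneAddOne.{u} := ⟨⊤⟩
  let : OrderBot OmegaOneAddOne.{u} := WellFoundedLT.toOrderBot _
  let := WellFoundedLT.conditionallyCompleteLinearOrderBot OmegaOneAddOne.{u}
  have h := isCompact_Icc (a := (⊥ : OmegaOneAddOne.{u})) (b := ⊤)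
  exact ⟨h.of_isClosed_subset isClosed_univ fun x _ => ⟨bot_le, le_top⟩⟩

theorem isOpen_Iic (a : OmegaOneAddOne.{u}) : IsOpen (Iic a) := by
  rcases eq_or_ne a ⊤ with rfl | ha
  · rw [Iic_top]; exact isOpen_univ
  · rw [← Order.Iio_succ_of_not_isMax (by rwa [isMax_iff_eq_top])]
    exact isOpen_Iio

/-- The indicator function of `(a, ω₁]`. -/
noncomputable def indicatorIoi (a : OmegaOneAddOne.{u}) : Cp OmegaOneAddOne.{u} :=
  ⟨(Ioi a).indicator 1, by
    have h : IsClopen (Ioi a) := by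
      rw [← compl_Iic]; exact ⟨(isOpen_Iic a).isClosed_compl, isClosed_Iic.isOpen_compl⟩
    exact continuous_one.indicator (by simp [h.frontier_eq])⟩

theorem exists_lt_top_forall_eq (f : Cp OmegaOneAddOne.{u}) :
    ∃ a < ⊤, ∀ x, a ≤ x → f.1 x = f.1 ⊤ := by
  have h : ∀ n : ℕ, ∃ a < (⊤ : OmegaOneAddOne.{u}),
      ∀ x, a < x → |f.1 x - f.1 ⊤| < 1 / ((n : ℝ) + 1) := by
    intro n
    have hn : (0 : ℝ) < 1 / ((n : ℝ) + 1) := by positivity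
    have hN := f.2.continuousAt (x := ⊤) (Metric.ball_mem_nhds _ hn)
    obtain ⟨b, hb, -⟩ := exists_lt_top_of_countable (s := (∅ : Set OmegaOneAddOne.{u}))
      countable_empty (by simp)
    obtain ⟨a, ha, hau⟩ := exists_Ioc_subset_of_mem_nhds hN ⟨b, hb⟩
    exact ⟨a, ha, fun x hx => by simpa [Real.dist_eq] using hau ⟨hx, le_top⟩⟩
  choose a ha hax using h
  obtain ⟨b, hb, hab⟩ := exists_lt_top_of_countable (countable_range a)
    (forall_mem_range.2 ha)
  refine ⟨b, hb, fun x hx => ?_⟩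
  have h0 : |f.1 x - f.1 ⊤| ≤ 0 := ge_of_tendsto' tendsto_one_div_add_atTop_nhds_zero_nat
    fun n => (hax n x ((hab _ (mem_range_self n)).trans_le hx)).le
  exact sub_eq_zero.1 (abs_nonpos_iff.1 h0)

instance instFrechetUrysohnSpaceCp : FrechetUrysohnSpace (Cp OmegaOneAddOne.{u}) := by
  refine Cp.frechetUrysohnSpace fun T hT => ?_
  choose a ha hax using exists_lt_top_forall_eq.{u}
  obtain ⟨b, hb, hab⟩ := exists_lt_top_of_countable (hT.image a)
    (forall_mem_image.2 fun f _ => ha f)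
  refine ⟨insert ⊤ (Iic b), (countable_Iic hb).insert _, fun x => ?_⟩
  rcases le_total x b with hx | hx
  · exact ⟨x, Or.inr hx, fun _ _ => rfl⟩
  · exact ⟨⊤, Or.inl rfl, fun h hh =>
      hax h x ((hab _ (mem_image_of_mem a hh)).le.trans hx)⟩

theorem isKappaSpace_Cp : IsKappaSpace (Cp OmegaOneAddOne.{u}) :=
  ⟨inferInstance, OmegaOneAddOne, inferInstance, inferInstance, inferInstance, id,
    IsClosedEmbedding.id⟩

theorem not_isDieudonneComplete_Cp : ¬ IsDieudonneComplete (Cp OmegaOneAddOne.{u}) := by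
  rintro ⟨-, U, hU, hc⟩
  have : Nonempty (Iio (⊤ : OmegaOneAddOne.{u})) := by
    obtain ⟨b, hb, -⟩ := exists_lt_top_of_countable (s := (∅ : Set OmegaOneAddOne.{u}))
      countable_empty (by simp)
    exact ⟨⟨b, hb⟩⟩
  let F : Iio (⊤ : OmegaOneAddOne.{u}) → Cp OmegaOneAddOne.{u} := fun a => indicatorIoi a
  have hF : @Cauchy _ U (map F atTop) := by
    refine (@cauchy_map_iff' _ _ U _ _ _).2 fun V hV => ?_
    obtain ⟨A, hA, hAV⟩ := Cp.exists_countable_eqOn_mem_uniformity U hU hV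
    obtain ⟨b, hb, hAb⟩ := exists_lt_top_of_countable (hA.mono (sdiff_subset (t := {⊤})))
      (fun x hx => lt_top_iff_ne_top.2 hx.2)
    rw [prod_atTop_atTop_eq]
    refine mem_map.2 (mem_of_superset (mem_atTop (⟨b, hb⟩, ⟨b, hb⟩)) ?_)
    rintro ⟨c, d⟩ ⟨hbc, hbd⟩
    -- Beyond `b`, both indicators are `0` on `A \ {⊤}` and `1` at `⊤`.
    refine hAV _ _ fun x hx => ?_
    have hbc' : b ≤ c.1 := hbc
    have hbd' : b ≤ d.1 := hbd
    rcases eq_or_ne x ⊤ with rfl | hx'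
    · have h₁ : c.1 < ⊤ := c.2
      have h₂ : d.1 < ⊤ := d.2
      simp [F, indicatorIoi, h₁, h₂]
    · have h := hAb x ⟨hx, hx'⟩
      simp [F, indicatorIoi, (h.le.trans hbc').not_gt, (h.le.trans hbd').not_gt]
  obtain ⟨f, hf⟩ := @CompleteSpace.complete _ U hc _ hF
  rw [hU] at hf
  have hlim := Cp.tendsto_iff.1 (show Tendsto F atTop (𝓝 f) from hf)
  have htop : f.1 ⊤ = 1 := tendsto_nhds_unique (hlim ⊤) <| by
    refine tendsto_const_nhds.congr fun c => ?_
    have h : c.1 < ⊤ := c.2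
    simp [F, indicatorIoi, h]
  have hlt : ∀ x < (⊤ : OmegaOneAddOne.{u}), f.1 x = 0 := fun x hx =>
    tendsto_nhds_unique (hlim x) <| by
      refine tendsto_const_nhds.congr' ?_
      filter_upwards [eventually_ge_atTop (⟨x, hx⟩ : Iio (⊤ : OmegaOneAddOne.{u}))] with c hc'
      have h : x ≤ c.1 := hc'
      simp [F, indicatorIoi, h.not_gt]
  obtain ⟨a, ha, hfa⟩ := exists_lt_top_forall_eq f
  have := hfa a le_rfl
  rw [hlt a ha, htop] at this
  exact zero_ne_one this

end OmegaOneAddOne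

theorem mainTheorem9 :
    (FrechetUrysohnSpace (Cp OmegaOneAddOne.{u}) ∧
      IsKappaSpace (Cp OmegaOneAddOne.{u}) ∧
      ¬ IsRealcompactSpace (Cp OmegaOneAddOne.{u}) ∧
      ¬ IsDieudonneComplete (Cp OmegaOneAddOne.{u})) ∧
    ∃ (X : Type u) (_ : TopologicalSpace X),
      FrechetUrysohnSpace X ∧ IsKappaSpace X ∧ ¬ IsDieudonneComplete X :=
  ⟨⟨inferInstance, OmegaOneAddOne.isKappaSpace_Cp,
    fun h => OmegaOneAddOne.not_isDieudonneComplete_Cp h.isDieudonneComplete,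
    OmegaOneAddOne.not_isDieudonneComplete_Cp⟩,
    Cp OmegaOneAddOne, inferInstance, inferInstance, OmegaOneAddOne.isKappaSpace_Cp,
    OmegaOneAddOne.not_isDieudonneComplete_Cp⟩
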